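/- Let $\mathcal K$ be a non-archimedean local field (a locally compact, non-discrete topological field whose topology is given by an absolute value $|\cdot|$ satisfying $|x+y|\le |x|\vee|y|$), let $q>1$ be such that $\{|x| : x\in\mathcal K\}=\{0\}\cup\{q^m : m\in\mathbb Z\}$, fix $\rho\in\mathcal K$ with $|\rho|=q^{-1}$, and let $\mathcal D=\{x\in\mathcal K : |x|\le 1\}$ be the ring of integers. A $\mathcal K$-valued random variable is called standard $\mathcal K$-Gaussian if its distribution is the restriction to $\mathcal D$ of the additive Haar measure $\lambda$ of $\mathcal K$ normalized by $\lambda(\mathcal D)=1$. A sequence $\xi=(\xi_i)_{i\in\mathbb N}$ of $\mathcal K$-valued random variables on a probability space $(\Omega,\mathcal F,\mathbb P)$ is called rotatable if, for every $n\in\mathbb N$ and every $U\in\mathrm{GL}_n(\mathcal D)$, the vectors $U(\xi_1,\dots,\xi_n)^\top$ and $(\xi_1,\dots,\xi_n)^\top$ have the same distribution. An extension of $(\Omega,\mathcal F,\mathbb P)$ is a probability space with a surjective measure-preserving map to $(\Omega,\mathcal F,\mathbb P)$; random variables on $\Omega$ are regarded as random variables on the extension by composition with this map. Then $\xi$ is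 rotatable if and only if both of the following hold. (1) $\sup_{i\in\mathbb N}|\xi_i|<\infty$ almost surely. (2) Possibly on some extension of $(\Omega,\mathcal F,\mathbb P)$, there are independent, identically distributed, standard $\mathcal K$-Gaussian random variables $\eta_1,\eta_2,\dots$ such that, almost surely, $\xi_i=\tau\eta_i$ for all $i\in\mathbb N$, and such that $\tau$ is independent of the sequence $(\eta_i)_{i\in\mathbb N}$. Here $\tau$ is the random variable with values in $\{\rho^m : m\in\mathbb Z\}\cup\{0\}$ given by \[ \tau=\begin{cases}\rho^m, & \sup_j|\xi_j|=q^{-m},\ m\in\mathbb Z,\\ 0, & \sup_j|\xi_j|=0,\end{cases} \] and by $\tau=0$ on the event where $\sup_j|\xi_j|=\infty$, which has probability zero under (1). -/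

import Mathlib

open MeasureTheory ProbabilityTheory
open scoped ENNReal

universe u v

/-- The ring of integers `D = {x : |x| ≤ 1}` of a non-archimedean normed field. -/
noncomputable abbrev ringOfIntegers (K : Type v) [NormedField K] [IsUltrametricDist K] : Subring K :=
  (NormedField.valuation (K := K)).integer

/-- `ρ` is a uniformizer: `|ρ|` is the largest value of the absolute value in `(0, 1)`.
Writing `|ρ| = q⁻¹`, the absolute value takes exactly the values `0` and `q ^ m`, `m ∈ ℤ`. -/
def IsUniformizer {K : Type v} [NormedField K] (ρ : K) : Prop :=
  ρ ≠ 0 ∧ ‖ρ‖ < 1 ∧ ∀ x : K, ‖x‖ < 1 → ‖x‖ ≤ ‖ρ‖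

/-- The closed unit ball `D` of a local field as a compact set with non-empty interior. -/
def unitBallCompacts (K : Type v) [NontriviallyNormedField K] [LocallyCompactSpace K] :
    TopologicalSpace.PositiveCompacts K where
  carrier := Metric.closedBall 0 1
  isCompact' := by
    have : ProperSpace K := ProperSpace.of_locallyCompactSpace K
    exact isCompact_closedBall 0 1
  interior_nonempty' :=
    ⟨0, Metric.ball_subset_interior_closedBall (Metric.mem_ball_self one_pos)⟩

/-- The law of a standard `K`-Gaussian random variable: the additive Haar measure of `K` that gives
`D` mass one, restricted to `D`. -/
noncomputable def stdKGaussian (K : Type v) [NontriviallyNormedField K] [LocallyCompactSpace K]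
    [MeasurableSpace K] [BorelSpace K] : Measure K :=
  (Measure.addHaarMeasure (unitBallCompacts K)).restrict (Metric.closedBall 0 1)

/-- A sequence of `K`-valued random variables is rotatable if `U (ξ₀, …, ξₙ₋₁)` has the same law as
`(ξ₀, …, ξₙ₋₁)` for every `n` and every `U ∈ GLₙ(D)`. -/
def Rotatable {K : Type v} [NormedField K] [IsUltrametricDist K] [MeasurableSpace K]
    {Ω : Type u} [MeasurableSpace Ω] (P : Measure Ω) (ξ : ℕ → Ω → K) : Prop :=
  ∀ (n : ℕ) (U : Matrix.GeneralLinearGroup (Fin n) (ringOfIntegers K)),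
    P.map (fun ω => ((U : Matrix (Fin n) (Fin n) (ringOfIntegers K)).map
        (fun a => (a : K))).mulVec (fun i : Fin n => ξ i ω)) =
      P.map (fun ω (i : Fin n) => ξ i ω)

/-- The supremum `sup_j |x_j| ∈ [0, ∞]` of a sequence. -/
noncomputable def supAbs {K : Type v} [NormedField K] (x : ℕ → K) : ℝ≥0∞ := ⨆ j, ‖x j‖ₑ

open Classical in
/-- `ρ ^ m` if `sup_j |x_j| = |ρ ^ m|` with `m ∈ ℤ` (this `m` is unique for a uniformizer `ρ`), and
`0` if `sup_j |x_j| = 0`; also `0`, by convention, if the supremum is infinite. -/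
noncomputable def scaleOf {K : Type v} [NormedField K] (ρ : K) (x : ℕ → K) : K :=
  if h : ∃ m : ℤ, supAbs x = ‖ρ ^ m‖ₑ then ρ ^ h.choose else 0

/-- `(Ω', P')`, with the projection `π`, is an extension of the probability space `(Ω, P)`. A random
variable `X` on `Ω` is regarded as the random variable `X ∘ π` on `Ω'`. -/
structure IsExtension {Ω : Type u} [MeasurableSpace Ω] (P : Measure Ω)
    {Ω' : Type (max u v)} [MeasurableSpace Ω'] (P' : Measure Ω') (π : Ω' → Ω) : Prop where
  isProbabilityMeasure : IsProbabilityMeasure P'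
  measurePreserving : MeasurePreserving π P' P
  surjective : Function.Surjective π

/-! If `ξ` is rotatable, its law is invariant under shears `x i ↦ x i + a i * x j` with integral `a`
and `a j = 0` (`Rotatable.shearInvariant`). Everything in the forward direction follows from this
invariance. The supremum is finite because adding the first large coordinate to `x 0` makes `x 0`
large whenever it was not already (`ShearInvariant.measure_exists_lt_norm_le`). The value group is
discrete, so a finite non-zero supremum `‖v‖` is attained, say at `j`. Averaging over Gaussian
coefficients `a`, the new coordinates `x i + a i * x j` are, for fixed `x`, independent copies of
`v` times a standard Gaussian, because the Gaussian law is invariant under translation by `D` and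
multiplication by units (`ShearInvariant.lintegral_resample`). Resampling shows that the maximum is
attained beyond every index `n`. Splitting by the first such index then shows that the first `n`
coordinates over `v` are standard Gaussian given the scale (`ShearInvariant.map_restrict_div`).
Where the scale vanishes, an auxiliary Gaussian sequence on a product extension serves as `η`.
Conversely, `GLₙ(D)` preserves the unit ball and its Haar measure, and an independent factor does
not spoil this. -/

/-! ### Standard Gaussian laws and their invariance. -/

/-- By uniqueness of Haar measure, `e` can only rescale `μ`; comparing masses on `C` forces the
factor to be one. -/
theorem map_restrict_eq_of_preimage_eq {E : Type*} [AddCommGroup E] [TopologicalSpace E]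
    [IsTopologicalAddGroup E] [SecondCountableTopology E] [LocallyCompactSpace E] [T2Space E]
    [MeasurableSpace E] [BorelSpace E] (μ : Measure E) [μ.IsAddHaarMeasure] (e : E ≃ₜ+ E)
    (C : TopologicalSpace.PositiveCompacts E) (h : e ⁻¹' (C : Set E) = C) :
    (μ.restrict C).map e = μ.restrict C := by
  have he : Measurable e := e.continuous.measurable
  have hC : MeasurableSet (C : Set E) := C.isCompact.measurableSet
  have : (μ.map e).IsAddHaarMeasure := e.isAddHaarMeasure_map μ
  have hμ : μ.map e = μ := by
    rw [Measure.addHaarMeasure_unique (μ.map e) C, Measure.map_apply he hC, h]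
    exact (Measure.addHaarMeasure_unique μ C).symm
  conv_lhs => rw [← h]
  rw [← Measure.restrict_map he hC, hμ]

theorem norm_mulVec_le_one {K : Type v} [NormedField K] [IsUltrametricDist K] {n : ℕ}
    (A : Matrix (Fin n) (Fin n) (ringOfIntegers K)) {x : Fin n → K}
    (hx : ‖x‖ ≤ 1) : ‖(A.map (fun a => (a : K))).mulVec x‖ ≤ 1 := by
  refine (pi_norm_le_iff_of_nonneg zero_le_one).2 fun i => ?_
  simp only [Matrix.mulVec, dotProduct]
  refine IsUltrametricDist.norm_sum_le_of_forall_le_of_nonneg zero_le_one fun j _ => ?_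
  have h : ‖((A i j : ringOfIntegers K) : K)‖ ≤ 1 := (A i j).2
  rw [norm_mul]
  exact mul_le_one₀ h (norm_nonneg _) ((norm_le_pi_norm x j).trans hx)

section LocalField

variable {K : Type v} [NontriviallyNormedField K]
  [LocallyCompactSpace K] [MeasurableSpace K] [BorelSpace K]

theorem secondCountableTopology_of_locallyCompactSpace (K : Type v) [NontriviallyNormedField K]
    [LocallyCompactSpace K] : SecondCountableTopology K := by
  have : ProperSpace K := ProperSpace.of_locallyCompactSpace K
  infer_instance

instance isProbabilityMeasure_stdKGaussian (K : Type v) [NontriviallyNormedField K]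
    [LocallyCompactSpace K] [MeasurableSpace K] [BorelSpace K] :
    IsProbabilityMeasure (stdKGaussian K) := by
  constructor
  rw [stdKGaussian, Measure.restrict_apply_univ]
  exact Measure.addHaarMeasure_self (K₀ := unitBallCompacts K)

theorem ae_stdKGaussian_norm_le_one : ∀ᵐ x ∂stdKGaussian K, ‖x‖ ≤ 1 := by
  filter_upwards [ae_restrict_mem Metric.isClosed_closedBall.measurableSet] with x hx
  simpa using hx

/-- The open unit ball around `1` consists of elements of norm one and has positive Haar measure. -/
theorem stdKGaussian_norm_ne_one_lt_one [IsUltrametricDist K] :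
    stdKGaussian K {x | ‖x‖ ≠ 1} < 1 := by
  have hm : MeasurableSet {x : K | ‖x‖ = 1} :=
    (isClosed_eq continuous_norm continuous_const).measurableSet
  have hsub : Metric.ball (1 : K) 1 ⊆ {x | ‖x‖ = 1} := fun x hx => by
    have h : ‖x - 1‖ < 1 := by simpa [dist_eq_norm] using hx
    have h' := IsUltrametricDist.norm_add_eq_max_of_norm_ne_norm (x := x - 1) (y := 1)
      (by simpa using h.ne)
    simpa [h.le] using h'
  have hpos : 0 < stdKGaussian K {x | ‖x‖ = 1} := by
    rw [stdKGaussian, Measure.restrict_apply hm, Set.inter_eq_left.2 fun x hx => by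
      simpa using (show ‖x‖ = 1 from hx).le]
    exact (Metric.isOpen_ball.measure_pos _ ⟨1, Metric.mem_ball_self one_pos⟩).trans_le
      (measure_mono hsub)
  have h := prob_compl_lt_one_sub_of_lt_prob hpos hm
  rwa [tsub_zero] at h

/-- The standard Gaussian law is invariant under affine isometries preserving the unit ball. -/
theorem map_affine_stdKGaussian [IsUltrametricDist K] {c b : K} (hc : ‖c‖ = 1) (hb : ‖b‖ ≤ 1) :
    (stdKGaussian K).map (fun x => b + x * c) = stdKGaussian K := by
  have := secondCountableTopology_of_locallyCompactSpace K
  have hc0 : c ≠ 0 := norm_ne_zero_iff.mp (by simp [hc])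
  have hmul : (stdKGaussian K).map (fun x => x * c) = stdKGaussian K := by
    let e : K ≃ₜ+ K :=
      { toFun := fun x => x * c
        invFun := fun x => x * c⁻¹
        left_inv := fun x => by simp [hc0]
        right_inv := fun x => by simp [hc0]
        map_add' := fun x y => add_mul x y c
        continuous_toFun := by fun_prop
        continuous_invFun := by fun_prop }
    refine map_restrict_eq_of_preimage_eq _ e (unitBallCompacts K) ?_
    ext x
    change x * c ∈ Metric.closedBall 0 1 ↔ x ∈ Metric.closedBall 0 1
    simp [hc]
  have hadd : (stdKGaussian K).map (fun x => b + x) = stdKGaussian K := by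
    have hpre : (fun x => b + x) ⁻¹' Metric.closedBall (0 : K) 1 = Metric.closedBall 0 1 := by
      ext x
      simp only [Set.mem_preimage, mem_closedBall_zero_iff]
      constructor
      · intro h
        have h' := IsUltrametricDist.norm_add_le_max (-b) (b + x)
        rw [neg_add_cancel_left, norm_neg] at h'
        exact h'.trans (max_le hb h)
      · intro h
        exact (IsUltrametricDist.norm_add_le_max b x).trans (max_le hb h)
    rw [stdKGaussian]
    conv_lhs => rw [← hpre]
    rw [← Measure.restrict_map (by fun_prop) Metric.isClosed_closedBall.measurableSet,
      map_add_left_eq_self]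
  conv_rhs => rw [← hadd, ← hmul]
  rw [Measure.map_map (by fun_prop) (by fun_prop)]
  rfl

/-- Standard Gaussian vectors are invariant under `GLₙ` of the ring of integers. -/
theorem map_mulVec_pi_stdKGaussian [IsUltrametricDist K] {n : ℕ}
    (U : Matrix.GeneralLinearGroup (Fin n) (ringOfIntegers K)) :
    (Measure.pi fun _ : Fin n => stdKGaussian K).map
      (((U : Matrix (Fin n) (Fin n) (ringOfIntegers K)).map (fun a => (a : K))).mulVec) =
      Measure.pi fun _ : Fin n => stdKGaussian K := by
  have := secondCountableTopology_of_locallyCompactSpace K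
  have : ProperSpace K := ProperSpace.of_locallyCompactSpace K
  set A : Matrix (Fin n) (Fin n) K :=
    (U : Matrix (Fin n) (Fin n) (ringOfIntegers K)).map (fun a => (a : K)) with hA
  set B : Matrix (Fin n) (Fin n) K :=
    ((U⁻¹ : Matrix.GeneralLinearGroup (Fin n) (ringOfIntegers K)) :
      Matrix (Fin n) (Fin n) (ringOfIntegers K)).map (fun a => (a : K)) with hB
  have hmap (V W : Matrix (Fin n) (Fin n) (ringOfIntegers K)) :
      (V * W).map (fun a => (a : K)) = V.map (fun a => (a : K)) * W.map (fun a => (a : K)) :=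
    Matrix.map_mul (f := (ringOfIntegers K).subtype)
  have hone : (1 : Matrix (Fin n) (Fin n) (ringOfIntegers K)).map (fun a => (a : K)) = 1 :=
    Matrix.map_one _ rfl rfl
  have hAB : A * B = 1 := by
    rw [hA, hB, ← hmap, ← Units.val_mul, mul_inv_cancel, Units.val_one, hone]
  have hBA : B * A = 1 := by
    rw [hA, hB, ← hmap, ← Units.val_mul, inv_mul_cancel, Units.val_one, hone]
  let e : (Fin n → K) ≃ₜ+ (Fin n → K) :=
    { toFun := A.mulVec
      invFun := B.mulVec
      left_inv := fun x => by rw [Matrix.mulVec_mulVec, hBA, Matrix.one_mulVec]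
      right_inv := fun x => by rw [Matrix.mulVec_mulVec, hAB, Matrix.one_mulVec]
      map_add' := fun x y => Matrix.mulVec_add A x y
      continuous_toFun := Continuous.matrix_mulVec continuous_const continuous_id
      continuous_invFun := Continuous.matrix_mulVec continuous_const continuous_id }
  let C : TopologicalSpace.PositiveCompacts (Fin n → K) :=
    { carrier := Metric.closedBall 0 1
      isCompact' := isCompact_closedBall 0 1
      interior_nonempty' :=
        ⟨0, Metric.ball_subset_interior_closedBall (Metric.mem_ball_self one_pos)⟩ }
  have hpi : (Measure.pi fun _ : Fin n => stdKGaussian K) =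
      (Measure.pi fun _ : Fin n => Measure.addHaarMeasure (unitBallCompacts K)).restrict C := by
    have hC : (C : Set (Fin n → K)) = Set.univ.pi fun _ => Metric.closedBall (0 : K) 1 :=
      closedBall_pi (0 : Fin n → K) zero_le_one
    rw [hC, Measure.restrict_pi_pi]
    rfl
  rw [hpi]
  refine map_restrict_eq_of_preimage_eq _ e C ?_
  ext x
  change A.mulVec x ∈ Metric.closedBall 0 1 ↔ x ∈ Metric.closedBall 0 1
  rw [mem_closedBall_zero_iff, mem_closedBall_zero_iff]
  refine ⟨fun h => ?_, norm_mulVec_le_one _⟩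
  have := norm_mulVec_le_one ((U⁻¹ : Matrix.GeneralLinearGroup (Fin n) (ringOfIntegers K)) :
      Matrix (Fin n) (Fin n) (ringOfIntegers K)) h
  rwa [← hB, Matrix.mulVec_mulVec, hBA, Matrix.one_mulVec] at this

/-- The law of a sequence of independent standard Gaussian random variables. -/
noncomputable def stdKGaussianSeq (K : Type v) [NontriviallyNormedField K] [LocallyCompactSpace K]
    [MeasurableSpace K] [BorelSpace K] : Measure (ℕ → K) :=
  Measure.infinitePi fun _ => stdKGaussian K

instance isProbabilityMeasure_stdKGaussianSeq (K : Type v) [NontriviallyNormedField K]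
    [LocallyCompactSpace K] [MeasurableSpace K] [BorelSpace K] :
    IsProbabilityMeasure (stdKGaussianSeq K) := by
  unfold stdKGaussianSeq; infer_instance

theorem map_eval_stdKGaussianSeq (i : ℕ) :
    (stdKGaussianSeq K).map (fun x => x i) = stdKGaussian K :=
  Measure.infinitePi_map_eval _ i

theorem map_fin_stdKGaussianSeq (n : ℕ) :
    (stdKGaussianSeq K).map (fun x (i : Fin n) => x i) =
      Measure.pi fun _ : Fin n => stdKGaussian K := by
  rw [← Measure.infinitePi_eq_pi]
  exact Measure.map_infinitePi_infinitePi_of_inj (P := fun _ : ℕ => stdKGaussian K)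
    (f := fun i : Fin n => (i : ℕ)) Fin.val_injective

theorem ae_stdKGaussianSeq_norm_le_one : ∀ᵐ a ∂stdKGaussianSeq K, ∀ i, ‖a i‖ ≤ 1 := by
  refine ae_all_iff.2 fun i => ?_
  have h := ae_stdKGaussian_norm_le_one (K := K)
  rw [← map_eval_stdKGaussianSeq i] at h
  exact ae_of_ae_map (measurable_pi_apply i).aemeasurable h

/-- By independence the event has probability at most `p ^ n` for every `n`, with a fixed `p < 1`.
-/
theorem stdKGaussianSeq_forall_ge_norm_ne_one [IsUltrametricDist K] (k : ℕ) :
    stdKGaussianSeq K {a | ∀ l, k ≤ l → ‖a l‖ ≠ 1} = 0 := by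
  have hm : MeasurableSet {x : K | ‖x‖ ≠ 1} :=
    (isClosed_eq continuous_norm continuous_const).measurableSet.compl
  have hle (n : ℕ) : stdKGaussianSeq K {a | ∀ l, k ≤ l → ‖a l‖ ≠ 1} ≤
      stdKGaussian K {x | ‖x‖ ≠ 1} ^ n := by
    calc stdKGaussianSeq K {a | ∀ l, k ≤ l → ‖a l‖ ≠ 1} ≤ stdKGaussianSeq K
          (Set.pi (Finset.Ico k (k + n) : Finset ℕ) fun _ => {x : K | ‖x‖ ≠ 1}) :=
        measure_mono fun a ha l hl => ha l (Finset.mem_Ico.1 hl).1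
      _ = _ := by
        rw [stdKGaussianSeq, Measure.infinitePi_pi _ fun _ _ => hm]
        simp
  exact le_antisymm (ge_of_tendsto'
    (ENNReal.tendsto_pow_atTop_nhds_zero_of_lt_one stdKGaussian_norm_ne_one_lt_one) hle) zero_le

/-- The right side does not involve `x`: a shear with Gaussian coefficients and a pivot `t` of
maximal norm erases the old coordinates. -/
theorem map_affine_stdKGaussianSeq [IsUltrametricDist K] {x : ℕ → K} {t v : K} (hv : v ≠ 0) (ht : ‖t‖ = ‖v‖)
    (hx : ∀ i, ‖x i‖ ≤ ‖v‖) :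
    (stdKGaussianSeq K).map (fun a i => x i + a i * t) =
      (stdKGaussianSeq K).map (fun a i => v * a i) := by
  have := secondCountableTopology_of_locallyCompactSpace K
  have hv' : ‖v‖ ≠ 0 := norm_ne_zero_iff.2 hv
  rw [stdKGaussianSeq, Measure.infinitePi_map_pi _ (f := fun i y => x i + y * t) (by fun_prop),
    Measure.infinitePi_map_pi _ (f := fun i y => v * y) (by fun_prop)]
  congr 1
  funext i
  have h := map_affine_stdKGaussian (K := K) (c := t / v) (b := x i / v)
    (by rw [norm_div, ht, div_self hv']) (by
      rw [norm_div]; exact div_le_one_of_le₀ (hx i) (norm_nonneg _))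
  conv_rhs => rw [← h]
  rw [Measure.map_map (by fun_prop) (by fun_prop)]
  congr 1
  funext y
  simp only [Function.comp]
  field_simp

end LocalField

/-! ### Shears and shear invariance of rotatable laws. -/

/-- Finite measures on a sequence space are determined by their initial marginals. -/
theorem ext_of_map_fin {X : Type*} [MeasurableSpace X] {μ ν : Measure (ℕ → X)} [IsFiniteMeasure μ]
    {N : ℕ} (h : ∀ n, N ≤ n → μ.map (fun x (i : Fin n) => x i) = ν.map (fun x (i : Fin n) => x i)) :
    μ = ν := by
  have hμ : IsProjectiveLimit μ fun I : Finset ℕ => μ.map I.restrict := fun _ => rfl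
  refine hμ.unique fun I => ?_
  let n := max N (I.sup id + 1)
  have hI (i : I) : (i : ℕ) < n :=
    lt_max_of_lt_right (Nat.lt_succ_of_le (Finset.le_sup (f := id) i.2))
  have hr : (I.restrict : (ℕ → X) → _) =
      (fun (y : Fin n → X) (i : I) => y ⟨i, hI i⟩) ∘ fun x (i : Fin n) => x i := rfl
  simp only [hr]
  rw [← Measure.map_map (by fun_prop) (by fun_prop),
    ← Measure.map_map (by fun_prop) (by fun_prop), h n (le_max_left _ _)]

/-- The shear that adds the multiple `a i` of the `j`-th coordinate to the `i`-th one. -/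
def shear {K : Type v} [Field K] (j : ℕ) (a x : ℕ → K) : ℕ → K := fun i => x i + a i * x j

theorem norm_shear_le {K : Type v} [NormedField K] [IsUltrametricDist K] {j : ℕ} {a x : ℕ → K}
    (ha : ∀ i, ‖a i‖ ≤ 1) {r : ℝ} (hx : ∀ i, ‖x i‖ ≤ r) (i : ℕ) : ‖shear j a x i‖ ≤ r := by
  refine (IsUltrametricDist.norm_add_le_max _ _).trans (max_le (hx i) ?_)
  rw [norm_mul]
  exact (mul_le_of_le_one_left (norm_nonneg _) (ha i)).trans (hx j)

theorem shear_neg_shear {K : Type v} [Field K] {j : ℕ} {a : ℕ → K} (ha : a j = 0) (x : ℕ → K) :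
    shear j (-a) (shear j a x) = x := by
  funext i
  simp [shear, ha]

/-- An integral shear does not increase a uniform bound, and its inverse is the integral shear by
`-a`. -/
theorem forall_norm_shear_le_iff {K : Type v} [NormedField K] [IsUltrametricDist K] {j : ℕ}
    {a : ℕ → K} (haj : a j = 0) (ha : ∀ i, ‖a i‖ ≤ 1) (x : ℕ → K) (r : ℝ) :
    (∀ i, ‖shear j a x i‖ ≤ r) ↔ ∀ i, ‖x i‖ ≤ r := by
  refine ⟨fun h => ?_, norm_shear_le ha⟩
  rw [← shear_neg_shear haj x]
  exact norm_shear_le (by simpa using ha) h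

/-- A measure on the space of sequences that is invariant under all shears with integral
coefficients. -/
def ShearInvariant {K : Type v} [NormedField K] [MeasurableSpace K] (μ : Measure (ℕ → K)) : Prop :=
  ∀ (j : ℕ) (a : ℕ → K), a j = 0 → (∀ i, ‖a i‖ ≤ 1) → μ.map (shear j a) = μ

theorem measurableSet_norm_eq {K : Type v} [NormedField K] [MeasurableSpace K] [BorelSpace K]
    (j : ℕ) (r : ℝ) : MeasurableSet {x : ℕ → K | ‖x j‖ = r} :=
  measurableSet_eq_fun (measurable_norm.comp (measurable_pi_apply j)) measurable_const

theorem measurableSet_forall_norm_le {K : Type v} [NormedField K] [MeasurableSpace K]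
    [BorelSpace K] (r : ℝ) : MeasurableSet {x : ℕ → K | ∀ i, ‖x i‖ ≤ r} := by
  rw [Set.ofPred_forall]
  exact .iInter fun i =>
    measurableSet_le (measurable_norm.comp (measurable_pi_apply i)) measurable_const

theorem measurable_shear {K : Type v} [NontriviallyNormedField K] [LocallyCompactSpace K]
    [MeasurableSpace K] [BorelSpace K] {α : Type*} [MeasurableSpace α] (j : ℕ)
    {a x : α → ℕ → K}
    (ha : Measurable a) (hx : Measurable x) : Measurable fun t => shear j (a t) (x t) := by
  have := secondCountableTopology_of_locallyCompactSpace K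
  unfold shear
  fun_prop

section LocalField

variable {K : Type v} [NontriviallyNormedField K] [IsUltrametricDist K]
  [LocallyCompactSpace K] [MeasurableSpace K] [BorelSpace K]

/-- A shear may move infinitely many coordinates, but on the first `n > j` of them it acts as an
element of `GLₙ(D)`, and these marginals determine the law. -/
theorem Rotatable.shearInvariant {Ω : Type u} [MeasurableSpace Ω] {P : Measure Ω}
    [IsProbabilityMeasure P] {ξ : ℕ → Ω → K} (hξ : ∀ i, Measurable (ξ i)) (h : Rotatable P ξ) :
    ShearInvariant (P.map fun ω i => ξ i ω) := by
  intro j a haj ha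
  have hm : Measurable fun ω i => ξ i ω := by fun_prop
  have hs : Measurable (shear j a) := measurable_shear j measurable_const measurable_id
  have : IsProbabilityMeasure (P.map fun ω i => ξ i ω) := Measure.isProbabilityMeasure_map
    hm.aemeasurable
  have : IsProbabilityMeasure ((P.map fun ω i => ξ i ω).map (shear j a)) :=
    Measure.isProbabilityMeasure_map hs.aemeasurable
  refine ext_of_map_fin (N := j + 1) fun n hn => ?_
  let b : ℕ → ringOfIntegers K := fun i => ⟨a i, ha i⟩
  let j' : Fin n := ⟨j, hn⟩
  let N : Matrix (Fin n) (Fin n) (ringOfIntegers K) :=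
    Matrix.vecMulVec (fun i => b i) (Pi.single j' 1)
  -- The condition `a j = 0` makes the rank-one matrix `N` square to zero, so `1 + N` has inverse `1
  -- - N`.
  have hNN : N * N = 0 := by
    have hb : b j = 0 := Subtype.ext haj
    simp [N, Matrix.vecMulVec_mul_vecMulVec, j', hb]
  let U : Matrix.GeneralLinearGroup (Fin n) (ringOfIntegers K) :=
    { val := 1 + N
      inv := 1 - N
      val_inv := by simp [mul_sub, add_mul, hNN]
      inv_val := by simp [sub_mul, mul_add, hNN] }
  have hU := h n U
  rw [Measure.map_map hs hm, Measure.map_map (by fun_prop) (hs.comp hm),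
    Measure.map_map (by fun_prop) hm]
  refine Eq.trans ?_ hU
  congr 1
  funext ω i
  have hUi (k : Fin n) : (((U : Matrix (Fin n) (Fin n) (ringOfIntegers K)) i k :
      ringOfIntegers K) : K) = (1 : Matrix (Fin n) (Fin n) K) i k +
        a i * (Pi.single j' 1 : Fin n → K) k := by
    by_cases hik : i = k <;> by_cases hjk : k = j' <;>
      simp [U, N, b, Matrix.vecMulVec_apply, Matrix.one_apply, hik, hjk]
    split_ifs <;> simp
  simp only [Function.comp, shear, Matrix.mulVec, dotProduct, Matrix.map_apply, hUi, add_mul,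
    Finset.sum_add_distrib]
  simp [Matrix.one_apply, Pi.single_apply, j']

/-! ### Resampling and the Gaussian law at a fixed scale. -/

/-- Resampling: where the `j`-th coordinate has maximal absolute value `‖v‖`, the coordinates in `M`
may be replaced by independent Gaussian random variables scaled by `v`. -/
theorem ShearInvariant.lintegral_resample {μ : Measure (ℕ → K)} [IsFiniteMeasure μ]
    (hμ : ShearInvariant μ) {v : K} (hv : v ≠ 0) {j : ℕ} {M : Set ℕ} (hj : j ∉ M)
    {F : Set (ℕ → K)} (hF : MeasurableSet F) (hFj : ∀ x ∈ F, ‖x j‖ = ‖v‖)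
    (hFle : ∀ x ∈ F, ∀ i, ‖x i‖ ≤ ‖v‖)
    (hinv : ∀ (a x : ℕ → K), (∀ i, ‖a i‖ ≤ 1) → (∀ i ∉ M, a i = 0) → (shear j a x ∈ F ↔ x ∈ F))
    {f : (ℕ → K) → ℝ≥0∞} (hf : Measurable f) [DecidablePred (· ∈ M)] :
    ∫⁻ x in F, f x ∂μ =
      ∫⁻ x in F, ∫⁻ a, f (M.piecewise (fun i => v * a i) x) ∂stdKGaussianSeq K ∂μ := by
  have := secondCountableTopology_of_locallyCompactSpace K
  have hpw (g : (ℕ → K) × (ℕ → K) → ℕ → K) (hg : Measurable g) :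
      Measurable fun p => M.piecewise (g p) p.2 := by
    refine measurable_pi_iff.2 fun i => ?_
    by_cases hi : i ∈ M
    · simpa [hi] using hg.eval
    · simpa [hi] using measurable_snd.eval
  let T : (ℕ → K) → (ℕ → K) → ℕ → K := fun a x => shear j (M.indicator a) x
  have hT : Measurable fun p : (ℕ → K) × (ℕ → K) => T p.1 p.2 := by
    refine measurable_shear j (measurable_pi_iff.2 fun i => ?_) measurable_snd
    by_cases hi : i ∈ M
    · simpa [hi] using measurable_fst.eval
    · simp [hi]
  have hT1 {a : ℕ → K} (ha : ∀ i, ‖a i‖ ≤ 1) (i : ℕ) : ‖M.indicator a i‖ ≤ 1 :=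
    (norm_indicator_le_norm_self _ _).trans (ha i)
  have key {a : ℕ → K} (ha : ∀ i, ‖a i‖ ≤ 1) :
      ∫⁻ x in F, f x ∂μ = ∫⁻ x in F, f (T a x) ∂μ := by
    have hTa : Measurable (T a) := hT.comp measurable_prodMk_left
    have hpre : T a ⁻¹' F = F := Set.ext fun x => hinv _ _ (hT1 ha) fun i hi => by simp [hi]
    conv_lhs => rw [← hμ j (M.indicator a) (by simp [hj]) (hT1 ha)]
    rw [setLIntegral_map hF hf hTa]
    rw [hpre]
  calc ∫⁻ x in F, f x ∂μ = ∫⁻ a, ∫⁻ x in F, f (T a x) ∂μ ∂stdKGaussianSeq K := by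
        -- Almost every Gaussian sequence is integral, so `key` can be averaged over `a`.
        have hae : (fun _ => ∫⁻ x in F, f x ∂μ) =ᵐ[stdKGaussianSeq K]
            fun a => ∫⁻ x in F, f (T a x) ∂μ := by
          filter_upwards [ae_stdKGaussianSeq_norm_le_one] with a ha using key ha
        rw [← lintegral_congr_ae hae, lintegral_const, measure_univ, mul_one]
    _ = ∫⁻ x in F, ∫⁻ a, f (T a x) ∂stdKGaussianSeq K ∂μ :=
        lintegral_lintegral_swap (hf.comp hT).aemeasurable
    _ = _ := by
        refine setLIntegral_congr_fun hF fun x hx => ?_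
        have hTx (a : ℕ → K) : T a x = M.piecewise (fun i => x i + a i * x j) x := by
          funext i
          by_cases hi : i ∈ M <;> simp [T, shear, hi]
        have hg : Measurable fun y : ℕ → K => f (M.piecewise y x) :=
          hf.comp ((hpw Prod.fst measurable_fst).comp measurable_prodMk_right)
        have hg' : Measurable fun (a : ℕ → K) i => x i + a i * x j := by fun_prop
        simp only [hTx]
        rw [← lintegral_map (f := fun y => f (M.piecewise y x)) hg hg', map_affine_stdKGaussianSeq hv (hFj x hx) (hFle x hx), lintegral_map hg (by fun_prop)]

/-- Resampling every coordinate except `j` gives a tail of independent Gaussians times `v`, which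
almost surely contains a term of norm `‖v‖`. -/
theorem ShearInvariant.measure_forall_ge_norm_ne {μ : Measure (ℕ → K)} [IsFiniteMeasure μ]
    (hμ : ShearInvariant μ) {v : K} (hv : v ≠ 0) (j k : ℕ) :
    μ {x | ((∀ i, ‖x i‖ ≤ ‖v‖) ∧ ‖x j‖ = ‖v‖) ∧ ∀ l, k ≤ l → ‖x l‖ ≠ ‖v‖} = 0 := by
  classical
  have hF : MeasurableSet {x : ℕ → K | (∀ i, ‖x i‖ ≤ ‖v‖) ∧ ‖x j‖ = ‖v‖} :=
    (measurableSet_forall_norm_le _).inter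
      (measurableSet_norm_eq _ _)
  have hG : MeasurableSet {x : ℕ → K | ∀ l, k ≤ l → ‖x l‖ ≠ ‖v‖} := by
    simp only [Set.ofPred_forall]
    exact .iInter fun l => .iInter fun _ => (measurableSet_norm_eq _ _).compl
  have h := hμ.lintegral_resample hv (j := j) (M := {j}ᶜ) (by simp) hF (fun x hx => hx.2)
    (fun x hx => hx.1) (fun a x ha haM => by
      have haj : a j = 0 := haM j (by simp)
      refine and_congr (forall_norm_shear_le_iff haj ha x _) ?_
      simp [shear, haj]) (measurable_one.indicator hG)
  rw [lintegral_indicator_one hG, Measure.restrict_apply hG, Set.inter_comm] at h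
  refine Eq.trans h ?_
  have hz (x : ℕ → K) : ∫⁻ a, Set.indicator {x : ℕ → K | ∀ l, k ≤ l → ‖x l‖ ≠ ‖v‖} 1
      (({j}ᶜ : Set ℕ).piecewise (fun i => v * a i) x) ∂stdKGaussianSeq K = 0 := by
    refine lintegral_eq_zero_of_ae_eq_zero ?_
    -- Starting beyond `j` avoids the one coordinate that is not resampled.
    have h0 := stdKGaussianSeq_forall_ge_norm_ne_one (K := K) (max k (j + 1))
    rw [measure_eq_zero_iff_ae_notMem] at h0
    filter_upwards [h0] with a ha
    refine Set.indicator_of_notMem (fun hmem => ha fun l hl h1 => ?_) _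
    refine hmem l (le_of_max_le_left hl) ?_
    have hlj : l ≠ j := (Nat.lt_of_succ_le (le_of_max_le_right hl)).ne'
    simp [hlj, h1]
  simp only [hz, lintegral_zero]

/-- On the event that the maximal absolute value is attained and equals `‖v‖`, the sequence divided
by `v` is a sequence of independent standard Gaussian random variables. -/
theorem ShearInvariant.map_restrict_div {μ : Measure (ℕ → K)} [IsFiniteMeasure μ]
    (hμ : ShearInvariant μ) {v : K} (hv : v ≠ 0) {F : Set (ℕ → K)}
    (hFdef : ∀ x, x ∈ F ↔ (∀ i, ‖x i‖ ≤ ‖v‖) ∧ ∃ j, ‖x j‖ = ‖v‖) :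
    (μ.restrict F).map (fun x i => x i / v) = μ F • stdKGaussianSeq K := by
  classical
  have hdiv : Measurable fun (x : ℕ → K) i => x i / v := by
    have := secondCountableTopology_of_locallyCompactSpace K
    fun_prop
  refine ext_of_map_fin (N := 0) fun n _ => Measure.ext fun B hB => ?_
  have hpr : Measurable fun (x : ℕ → K) (i : Fin n) => x i := by fun_prop
  let C : Set (ℕ → K) := (fun (x : ℕ → K) (i : Fin n) => x i / v) ⁻¹' B
  have hC : MeasurableSet C := (hpr.comp hdiv) hB
  -- Here `j` is the first index `≥ n` at which the maximum `‖v‖` is attained; up to a null set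
  -- these events partition `F`.
  let E : ℕ → Set (ℕ → K) := fun j =>
    {x | (∀ i, ‖x i‖ ≤ ‖v‖) ∧ n ≤ j ∧ ‖x j‖ = ‖v‖ ∧ ∀ l, n ≤ l → l < j → ‖x l‖ ≠ ‖v‖}
  have hE (j : ℕ) : MeasurableSet (E j) := by
    have hlt : MeasurableSet {x : ℕ → K | ∀ l, n ≤ l → l < j → ‖x l‖ ≠ ‖v‖} := by
      simp only [Set.ofPred_forall]
      exact .iInter fun l => .iInter fun _ => .iInter fun _ => (measurableSet_norm_eq _ _).compl
    exact (measurableSet_forall_norm_le ‖v‖).inter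
      (.inter (.const _) ((measurableSet_norm_eq j ‖v‖).inter hlt))
  have hdisj : Pairwise (Function.onFun Disjoint E) := by
    intro i j hij
    refine Set.disjoint_left.2 fun x hi hj => ?_
    rcases lt_or_gt_of_ne hij with h | h
    · exact hj.2.2.2 i hi.2.1 h hi.2.2.1
    · exact hi.2.2.2 j hj.2.1 h hj.2.2.1
  have hsub : (⋃ j, E j) ⊆ F := Set.iUnion_subset fun j x hx => (hFdef x).2 ⟨hx.1, j, hx.2.2.1⟩
  have hFE : F =ᵐ[μ] ⋃ j, E j := by
    have hnull : ∀ᵐ x ∂μ, ∀ j, ¬ (((∀ i, ‖x i‖ ≤ ‖v‖) ∧ ‖x j‖ = ‖v‖) ∧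
        ∀ l, n ≤ l → ‖x l‖ ≠ ‖v‖) :=
      ae_all_iff.2 fun j => measure_eq_zero_iff_ae_notMem.1 (hμ.measure_forall_ge_norm_ne hv j n)
    filter_upwards [hnull] with x hx
    refine propext ⟨fun hxF => ?_, fun h => hsub h⟩
    obtain ⟨hle, j, hj⟩ := (hFdef x).1 hxF
    have hex : ∃ l, n ≤ l ∧ ‖x l‖ = ‖v‖ := by
      by_contra! hcon
      exact hx j ⟨⟨hle, hj⟩, hcon⟩
    refine Set.mem_iUnion.2 ⟨Nat.find hex, hle, (Nat.find_spec hex).1, (Nat.find_spec hex).2,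
      fun l hl hlt heq => Nat.find_min hex hlt ⟨hl, heq⟩⟩
  have hEC (j : ℕ) : μ (E j ∩ C) =
      μ (E j) * stdKGaussianSeq K ((fun (x : ℕ → K) (i : Fin n) => x i) ⁻¹' B) := by
    by_cases hnj : n ≤ j
    swap
    · have : E j = ∅ := Set.eq_empty_of_forall_notMem fun x hx => hnj hx.2.1
      simp [this]
    -- Apart from the shear-invariant uniform bound, `E j` only constrains coordinates `≥ n`, so it
    -- is unaffected by resampling those below `n`.
    have h := hμ.lintegral_resample hv (j := j) (M := {l | l < n}) (by simpa using hnj) (hE j)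
      (fun x hx => hx.2.2.1) (fun x hx => hx.1) (fun a x ha haM => by
        have haj : a j = 0 := haM j (by simpa using hnj)
        refine and_congr (forall_norm_shear_le_iff haj ha x _) (and_congr_right fun _ => ?_)
        refine and_congr (by simp [shear, haj]) ?_
        refine forall_congr' fun l => forall_congr' fun hl => ?_
        have hal : a l = 0 := haM l (by simpa using hl)
        simp [shear, hal]) (measurable_one.indicator hC)
    rw [lintegral_indicator_one hC, Measure.restrict_apply hC, Set.inter_comm] at h
    rw [h]
    have hin (x a : ℕ → K) : C.indicator 1 (({l | l < n} : Set ℕ).piecewise (fun i => v * a i) x) =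
        ((fun (x : ℕ → K) (i : Fin n) => x i) ⁻¹' B).indicator (1 : (ℕ → K) → ℝ≥0∞) a := by
      have : (({l | l < n} : Set ℕ).piecewise (fun i => v * a i) x) ∈ C ↔
          a ∈ (fun (x : ℕ → K) (i : Fin n) => x i) ⁻¹' B := by
        simp only [C, Set.mem_preimage]
        have : (fun i : Fin n => ({l | l < n} : Set ℕ).piecewise (fun i => v * a i) x i / v) =
            fun i : Fin n => a i := by
          funext i
          simp [hv]
        rw [this]
      simp only [Set.indicator_apply, this]
      rfl
    simp only [hin]
    rw [setLIntegral_const, lintegral_indicator_one (hpr hB), mul_comm]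
  rw [Measure.map_map hpr hdiv, Measure.map_apply (hpr.comp hdiv) hB,
    Measure.map_smul, Measure.smul_apply, Measure.map_apply hpr hB, smul_eq_mul]
  change μ.restrict F C = _
  rw [Measure.restrict_congr_set hFE, Measure.restrict_apply hC, Set.inter_comm, Set.iUnion_inter,
    measure_iUnion (fun i j h => (hdisj h).mono Set.inter_subset_left Set.inter_subset_left)
      (fun j => (hE j).inter hC), measure_congr hFE, measure_iUnion hdisj hE]
  simp only [hEC, ENNReal.tsum_mul_right]

end LocalField

/-! ### Discreteness of the absolute value and the scale. -/

section Scale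

variable {K : Type v} [NormedField K] {ρ : K}

theorem IsUniformizer.norm_pos (hρ : IsUniformizer ρ) : 0 < ‖ρ‖ := norm_pos_iff.2 hρ.1

theorem IsUniformizer.norm_le_mul_of_lt (hρ : IsUniformizer ρ) {x y : K} (h : ‖x‖ < ‖y‖) :
    ‖x‖ ≤ ‖ρ‖ * ‖y‖ := by
  have hy : 0 < ‖y‖ := (norm_nonneg x).trans_lt h
  have := hρ.2.2 (x / y) (by rwa [norm_div, div_lt_one hy])
  rwa [norm_div, div_le_iff₀ hy] at this

theorem IsUniformizer.exists_norm_eq_zpow (hρ : IsUniformizer ρ) {x : K} (hx : x ≠ 0) :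
    ∃ m : ℤ, ‖x‖ = ‖ρ ^ m‖ := by
  obtain ⟨m, h1, h2⟩ := exists_mem_Ico_zpow (norm_pos_iff.2 hx)
    ((one_lt_inv₀ hρ.norm_pos).2 hρ.2.1)
  refine ⟨-m, le_antisymm ?_ (by simpa [norm_zpow] using h1)⟩
  -- A norm strictly between consecutive powers of `‖ρ‖` would contradict the gap in
  -- `norm_le_mul_of_lt`.
  by_contra! h
  have h3 := hρ.norm_le_mul_of_lt h
  rw [norm_zpow, zpow_neg, ← inv_zpow] at h3
  rw [zpow_add_one₀ (inv_ne_zero hρ.norm_pos.ne'), ← div_eq_mul_inv,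
    lt_div_iff₀ hρ.norm_pos, mul_comm] at h2
  exact h2.not_ge h3

/-- Pick a term above `‖ρ‖ₑ` times the supremum. A larger term would exceed it by a factor of at
least `‖ρ‖⁻¹`, hence exceed the supremum. -/
theorem IsUniformizer.exists_supAbs_eq (hρ : IsUniformizer ρ) {x : ℕ → K} (h0 : supAbs x ≠ 0)
    (htop : supAbs x ≠ ∞) : ∃ j, supAbs x = ‖x j‖ₑ := by
  have hρ1 : ‖ρ‖ₑ < 1 := by
    rw [← ofReal_norm, ENNReal.ofReal_lt_one]
    exact hρ.2.1
  have hlt : ‖ρ‖ₑ * supAbs x < supAbs x := by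
    simpa using ENNReal.mul_lt_mul_left h0 htop hρ1
  obtain ⟨j, hj⟩ := lt_iSup_iff.1 hlt
  refine ⟨j, le_antisymm (iSup_le fun l => ?_) (le_iSup (fun j => ‖x j‖ₑ) j)⟩
  by_contra! h
  have h1 : ‖x j‖ < ‖x l‖ := not_le.1 fun h' => h.not_ge (enorm_le_iff_norm_le.2 h')
  have h2 : ‖x j‖ ≤ ‖ρ * x l‖ := by simpa using hρ.norm_le_mul_of_lt h1
  have h3 : ‖x j‖ₑ ≤ ‖ρ‖ₑ * ‖x l‖ₑ := by
    rw [← enorm_mul]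
    exact enorm_le_iff_norm_le.2 h2
  exact hj.not_ge (h3.trans (by gcongr; exact le_iSup (fun j => ‖x j‖ₑ) l))

theorem IsUniformizer.supAbs_eq_enorm_iff (hρ : IsUniformizer ρ) {v : K} (hv : v ≠ 0)
    (x : ℕ → K) : supAbs x = ‖v‖ₑ ↔ (∀ i, ‖x i‖ ≤ ‖v‖) ∧ ∃ j, ‖x j‖ = ‖v‖ := by
  constructor
  · intro h
    obtain ⟨j, hj⟩ := hρ.exists_supAbs_eq (x := x) (by simp [h, hv]) (by simp [h])
    refine ⟨fun i => enorm_le_iff_norm_le.1 (h ▸ le_iSup (fun j => ‖x j‖ₑ) i), j, ?_⟩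
    have hjv := hj.symm.trans h
    exact le_antisymm (enorm_le_iff_norm_le.1 hjv.le) (enorm_le_iff_norm_le.1 hjv.ge)
  · rintro ⟨h, j, hj⟩
    refine le_antisymm (iSup_le fun i => enorm_le_iff_norm_le.2 (h i)) ?_
    exact (enorm_le_iff_norm_le.2 hj.ge).trans (le_iSup (fun j => ‖x j‖ₑ) j)

theorem scaleOf_eq_zero_or_zpow (x : ℕ → K) :
    scaleOf ρ x = 0 ∨ ∃ m : ℤ, scaleOf ρ x = ρ ^ m ∧ supAbs x = ‖ρ ^ m‖ₑ := by
  unfold scaleOf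
  split_ifs with h
  · exact .inr ⟨_, rfl, h.choose_spec⟩
  · exact .inl rfl

theorem IsUniformizer.scaleOf_eq_zpow_iff (hρ : IsUniformizer ρ) (x : ℕ → K) (m : ℤ) :
    scaleOf ρ x = ρ ^ m ↔ supAbs x = ‖ρ ^ m‖ₑ := by
  have hm : ρ ^ m ≠ 0 := zpow_ne_zero m hρ.1
  constructor
  · intro h
    rcases scaleOf_eq_zero_or_zpow (ρ := ρ) x with h' | ⟨k, hk, hk'⟩
    · exact absurd (h.symm.trans h') hm
    · rw [← h, hk, hk']
  · intro h
    have hex : ∃ m : ℤ, supAbs x = ‖ρ ^ m‖ₑ := ⟨m, h⟩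
    rw [scaleOf, dif_pos hex]
    have heq : ‖ρ ^ hex.choose‖ₑ = ‖ρ ^ m‖ₑ := hex.choose_spec.symm.trans h
    have heq' : ‖ρ‖ ^ hex.choose = ‖ρ‖ ^ m := by
      rw [← norm_zpow, ← norm_zpow]
      exact le_antisymm (enorm_le_iff_norm_le.1 heq.le) (enorm_le_iff_norm_le.1 heq.ge)
    rw [zpow_right_injective₀ hρ.norm_pos hρ.2.1.ne heq']

theorem IsUniformizer.eq_zero_of_scaleOf_eq_zero (hρ : IsUniformizer ρ) {x : ℕ → K}
    (htop : supAbs x ≠ ∞) (h : scaleOf ρ x = 0) (i : ℕ) : x i = 0 := by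
  have h0 : supAbs x = 0 := by
    by_contra h0
    obtain ⟨j, hj⟩ := hρ.exists_supAbs_eq h0 htop
    have hxj : x j ≠ 0 := by
      intro hxj
      simp [hj, hxj] at h0
    obtain ⟨m, hm⟩ := hρ.exists_norm_eq_zpow hxj
    have hs : supAbs x = ‖ρ ^ m‖ₑ := by rw [hj, ← ofReal_norm, hm, ofReal_norm]
    exact zpow_ne_zero m hρ.1 (((hρ.scaleOf_eq_zpow_iff x m).2 hs).symm.trans h)
  simpa using ENNReal.iSup_eq_zero.1 h0 i

theorem countable_insert_zero_range_zpow (ρ : K) :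
    (insert 0 (Set.range fun m : ℤ => ρ ^ m)).Countable :=
  (Set.countable_range _).insert 0

theorem scaleOf_mem (ρ : K) (x : ℕ → K) :
    scaleOf ρ x ∈ insert 0 (Set.range fun m : ℤ => ρ ^ m) := by
  rcases scaleOf_eq_zero_or_zpow (ρ := ρ) x with h | ⟨m, h, -⟩
  · exact .inl h
  · exact .inr ⟨m, h.symm⟩

theorem measurable_supAbs [MeasurableSpace K] [BorelSpace K] :
    Measurable (supAbs : (ℕ → K) → ℝ≥0∞) :=
  .iSup fun i => measurable_enorm.comp (measurable_pi_apply i)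

theorem measurable_scaleOf [MeasurableSpace K] [BorelSpace K] (ρ : K) :
    Measurable (scaleOf ρ) := by
  classical
  -- The scale factors through `supAbs` by a function that vanishes off a countable set.
  let g : ℝ≥0∞ → K := fun s => if h : ∃ m : ℤ, s = ‖ρ ^ m‖ₑ then ρ ^ h.choose else 0
  have hg : Measurable g := by
    refine (measurable_const (a := (0 : K))).measurable_of_countable_ne
      ((Set.countable_range fun m : ℤ => ‖ρ ^ m‖ₑ).mono fun s hs => ?_)
    by_contra hcon
    refine hs (Eq.symm (dif_neg ?_))
    rintro ⟨m, rfl⟩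
    exact hcon ⟨m, rfl⟩
  exact hg.comp measurable_supAbs

end Scale

/-! ### Finiteness of the supremum, and rotatability of scaled Gaussian sequences. -/

section LocalField

variable {K : Type v} [NontriviallyNormedField K] [IsUltrametricDist K]
  [LocallyCompactSpace K] [MeasurableSpace K] [BorelSpace K]

/-- A maximal inequality by first passage: let `j ≥ 1` be the first index exceeding `r`. Either `x
0` exceeds `r`, or `x 0 + x j` does, having the norm of `x j`. Both alternatives have the same
measure within `E j`, whence the factor `2`. -/
theorem ShearInvariant.measure_exists_lt_norm_le {μ : Measure (ℕ → K)}
    (hμ : ShearInvariant μ) (r : ℝ) :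
    μ {x | ∃ j, 1 ≤ j ∧ r < ‖x j‖} ≤ 2 * μ {x | r < ‖x 0‖} := by
  have hlt (j : ℕ) : MeasurableSet {x : ℕ → K | r < ‖x j‖} :=
    measurableSet_lt measurable_const (by fun_prop)
  let E : ℕ → Set (ℕ → K) := fun j =>
    {x | 1 ≤ j ∧ r < ‖x j‖ ∧ ∀ l, 1 ≤ l → l < j → ¬ r < ‖x l‖}
  have hE (j : ℕ) : MeasurableSet (E j) := by
    simp only [E, Set.ofPred_and, Set.ofPred_forall]
    refine .inter (.const _) (.inter (hlt j) ?_)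
    exact .iInter fun l => .iInter fun _ => .iInter fun _ => (hlt l).compl
  have hdisj : Pairwise (Function.onFun Disjoint E) := by
    intro i j hij
    refine Set.disjoint_left.2 fun x hi hj => ?_
    rcases lt_or_gt_of_ne hij with h | h
    · exact hj.2.2 i hi.1 h hi.2.1
    · exact hi.2.2 j hj.1 h hj.2.1
  have hsub : {x | ∃ j, 1 ≤ j ∧ r < ‖x j‖} ⊆ ⋃ j, E j := by
    classical
    intro x hx
    refine Set.mem_iUnion.2 ⟨Nat.find hx, (Nat.find_spec hx).1, (Nat.find_spec hx).2,
      fun l hl hlt hr => Nat.find_min hx hlt ⟨hl, hr⟩⟩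
  have hle (j : ℕ) : μ (E j) ≤ 2 * μ (E j ∩ {x | r < ‖x 0‖}) := by
    by_cases hj : 1 ≤ j
    swap
    · have : E j = ∅ := Set.eq_empty_of_forall_notMem fun x hx => hj hx.1
      simp [this]
    have hj0 : j ≠ 0 := by lia
    let T : (ℕ → K) → ℕ → K := shear j (Pi.single 0 1)
    have hT : Measurable T := measurable_shear j measurable_const measurable_id
    have hTl (x : ℕ → K) {l : ℕ} (hl : 1 ≤ l) : T x l = x l := by
      have : l ≠ 0 := by lia
      simp [T, shear, this]
    have hTmap : μ.map T = μ := hμ j _ (by simp [hj0]) fun i => by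
      by_cases hi : i = 0 <;> simp [hi]
    have hTE (x : ℕ → K) : T x ∈ E j ↔ x ∈ E j := by
      refine and_congr_right fun _ => and_congr (by rw [hTl x hj]) ?_
      exact forall_congr' fun l => forall_congr' fun hl => by rw [hTl x hl]
    have hcover : E j ⊆ (E j ∩ {x | r < ‖x 0‖}) ∪ T ⁻¹' (E j ∩ {x | r < ‖x 0‖}) := by
      intro x hx
      by_cases h0 : r < ‖x 0‖
      · exact .inl ⟨hx, h0⟩
      · refine .inr ⟨(hTE x).2 hx, ?_⟩
        have hne : ‖x 0‖ < ‖x j‖ := (not_lt.1 h0).trans_lt hx.2.1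
        have h1 : ‖T x 0‖ = ‖x j‖ := by
          simpa [T, shear, hne.le] using
            IsUltrametricDist.norm_add_eq_max_of_norm_ne_norm hne.ne
        exact hx.2.1.trans_eq h1.symm
    calc μ (E j) ≤ μ (E j ∩ {x | r < ‖x 0‖}) + μ (T ⁻¹' (E j ∩ {x | r < ‖x 0‖})) :=
          (measure_mono hcover).trans (measure_union_le _ _)
      _ = 2 * μ (E j ∩ {x | r < ‖x 0‖}) := by
          rw [← Measure.map_apply hT ((hE j).inter (hlt 0)), hTmap, two_mul]
  calc μ {x | ∃ j, 1 ≤ j ∧ r < ‖x j‖} ≤ μ (⋃ j, E j) := measure_mono hsub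
    _ = ∑' j, μ (E j) := measure_iUnion hdisj hE
    _ ≤ ∑' j, 2 * μ (E j ∩ {x | r < ‖x 0‖}) := ENNReal.tsum_le_tsum hle
    _ = 2 * μ (⋃ j, E j ∩ {x | r < ‖x 0‖}) := by
        rw [ENNReal.tsum_mul_left, measure_iUnion
          (fun i j h => (hdisj h).mono Set.inter_subset_left Set.inter_subset_left)
          fun j => (hE j).inter (hlt 0)]
    _ ≤ 2 * μ {x | r < ‖x 0‖} := by
        gcongr
        exact Set.iUnion_subset fun j => Set.inter_subset_right

theorem ShearInvariant.ae_supAbs_lt_top {μ : Measure (ℕ → K)} [IsFiniteMeasure μ]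
    (hμ : ShearInvariant μ) : ∀ᵐ x ∂μ, supAbs x < ∞ := by
  have hlim : Filter.Tendsto (fun n : ℕ => 2 * μ {x | (n : ℝ) < ‖x 0‖}) Filter.atTop
      (nhds 0) := by
    have hanti : Antitone fun n : ℕ => {x : ℕ → K | (n : ℝ) < ‖x 0‖} := fun m n hmn x hx =>
      (Nat.cast_le.2 hmn : (m : ℝ) ≤ n).trans_lt hx
    have h := tendsto_measure_iInter_atTop (μ := μ) (s := fun n : ℕ => {x | (n : ℝ) < ‖x 0‖})
      (fun n => (measurableSet_lt (measurable_const (a := (n : ℝ)))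
        (by fun_prop : Measurable fun x : ℕ → K => ‖x 0‖)).nullMeasurableSet)
      hanti ⟨0, measure_ne_top _ _⟩
    have hempty : ⋂ n : ℕ, {x : ℕ → K | (n : ℝ) < ‖x 0‖} = ∅ := by
      refine Set.eq_empty_of_forall_notMem fun x hx => ?_
      obtain ⟨n, hn⟩ := exists_nat_ge ‖x 0‖
      exact hn.not_gt (Set.mem_iInter.1 hx n)
    rw [hempty, measure_empty] at h
    simpa using ENNReal.Tendsto.const_mul h (.inr ENNReal.ofNat_ne_top)
  rw [ae_iff]
  refine le_antisymm (ge_of_tendsto' hlim fun n => ?_) zero_le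
  refine (measure_mono fun x hx => ?_).trans (hμ.measure_exists_lt_norm_le n)
  by_contra hcon
  refine hx ?_
  have hb (i : ℕ) : ‖x i‖ₑ ≤ max ‖x 0‖ₑ n := by
    rcases Nat.eq_zero_or_pos i with rfl | hi
    · exact le_max_left _ _
    · refine le_max_of_le_right ?_
      have hin : ‖x i‖ ≤ n := not_lt.1 fun h => hcon ⟨i, hi, h⟩
      rw [← ofReal_norm]
      exact (ENNReal.ofReal_le_ofReal hin).trans_eq (ENNReal.ofReal_natCast n)
  exact (iSup_le hb).trans_lt (max_lt enorm_lt_top (ENNReal.natCast_lt_top n))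

/-- A scaled sequence of independent standard Gaussian random variables is rotatable if the scaling
factor is independent of it. -/
theorem rotatable_mul_of_indepFun {Ω : Type*} [MeasurableSpace Ω] {P : Measure Ω}
    [IsProbabilityMeasure P] {τ : Ω → K} {η : ℕ → Ω → K} (hτ : Measurable τ)
    (hη : ∀ i, Measurable (η i)) (hlaw : ∀ i, P.map (η i) = stdKGaussian K) (hind : iIndepFun η P)
    (hτη : IndepFun τ (fun ω i => η i ω) P) : Rotatable P fun i ω => τ ω * η i ω := by
  have := secondCountableTopology_of_locallyCompactSpace K
  intro n U
  set A : Matrix (Fin n) (Fin n) K :=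
    (U : Matrix (Fin n) (Fin n) (ringOfIntegers K)).map (fun a => (a : K)) with hA
  have hAm : Measurable A.mulVec :=
    (Continuous.matrix_mulVec continuous_const continuous_id).measurable
  have hηm : Measurable fun ω i => η i ω := by fun_prop
  have hηn : Measurable fun ω (i : Fin n) => η i ω := by fun_prop
  have hpr : Measurable fun (x : ℕ → K) (i : Fin n) => x i := by fun_prop
  have hseq : P.map (fun ω i => η i ω) = stdKGaussianSeq K := by
    rw [(iIndepFun_iff_map_fun_eq_infinitePi_map hη).1 hind]
    simp only [hlaw]
    rfl
  have hfin : P.map (fun ω (i : Fin n) => η i ω) = Measure.pi fun _ : Fin n => stdKGaussian K := by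
    rw [← map_fin_stdKGaussianSeq, ← hseq, Measure.map_map hpr hηm]
    rfl
  have hAfin : P.map (fun ω => A.mulVec fun i : Fin n => η i ω) =
      P.map (fun ω (i : Fin n) => η i ω) := by
    rw [hfin, ← map_mulVec_pi_stdKGaussian U, ← hfin, Measure.map_map hAm hηn]
    rfl
  have hAηn : Measurable fun ω => A.mulVec fun i : Fin n => η i ω := hAm.comp hηn
  have hind1 : IndepFun τ (fun ω (i : Fin n) => η i ω) P := hτη.comp measurable_id hpr
  have hind2 : IndepFun τ (fun ω => A.mulVec fun i : Fin n => η i ω) P :=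
    hτη.comp measurable_id (hAm.comp hpr)
  -- Independence makes both joint laws products with equal factors; scaling by `τ` commutes with
  -- `A`.
  have hjoint : P.map (fun ω => (τ ω, A.mulVec fun i : Fin n => η i ω)) =
      P.map (fun ω => (τ ω, fun i : Fin n => η i ω)) := by
    rw [(indepFun_iff_map_prod_eq_prod_map_map hτ.aemeasurable hAηn.aemeasurable).1 hind2,
      (indepFun_iff_map_prod_eq_prod_map_map hτ.aemeasurable hηn.aemeasurable).1 hind1, hAfin]
  have hmul : Measurable fun p : K × (Fin n → K) => p.1 • p.2 := by fun_prop
  have h := congrArg (Measure.map fun p : K × (Fin n → K) => p.1 • p.2) hjoint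
  rw [Measure.map_map hmul (hτ.prodMk hAηn), Measure.map_map hmul (hτ.prodMk hηn)] at h
  refine Eq.trans ?_ h
  congr 1
  funext ω
  exact Matrix.mulVec_smul A (τ ω) fun i : Fin n => η i ω

end LocalField

theorem measure_eq_tsum_inter_preimage_singleton {α β : Type*} [MeasurableSpace α]
    [MeasurableSpace β] [MeasurableSingletonClass β] (μ : Measure α) {f : α → β}
    (hf : Measurable f) {V : Set β} (hV : V.Countable) (hfV : ∀ x, f x ∈ V) {S : Set α}
    (hS : MeasurableSet S) : μ S = ∑' c : V, μ (S ∩ f ⁻¹' {(c : β)}) := by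
  have : Countable V := hV
  rw [← measure_iUnion]
  · congr 1
    ext x
    simp [hfV x]
  · intro c d hcd
    refine Set.disjoint_left.2 fun x hc hd => hcd (Subtype.ext ?_)
    exact (hc.2 : f x = c).symm.trans hd.2
  · exact fun c => hS.inter (hf (measurableSet_singleton _))

/-! ### Independence of the scale and the normalized sequence. -/

open Classical in
/-- The sequence `x` divided by its scale, where the scale is non-zero, and `a` elsewhere. -/
noncomputable def divByScale {K : Type v} [NormedField K] (ρ : K) (x a : ℕ → K) : ℕ → K :=
  if scaleOf ρ x = 0 then a else fun i => x i / scaleOf ρ x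

section LocalField

variable {K : Type v} [NontriviallyNormedField K]
  [LocallyCompactSpace K] [MeasurableSpace K] [BorelSpace K]

theorem measurable_divByScale (ρ : K) :
    Measurable fun p : (ℕ → K) × (ℕ → K) => divByScale ρ p.1 p.2 := by
  have := secondCountableTopology_of_locallyCompactSpace K
  have hs : Measurable fun p : (ℕ → K) × (ℕ → K) => scaleOf ρ p.1 :=
    (measurable_scaleOf ρ).comp measurable_fst
  unfold divByScale
  refine Measurable.ite (hs (measurableSet_singleton 0)) measurable_snd ?_
  exact measurable_pi_iff.2 fun i => (measurable_fst.eval).div hs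

/-- Under a shear invariant law, the normalized sequence is a sequence of independent standard
Gaussian random variables that is independent of the scale. -/
theorem ShearInvariant.map_scaleOf_divByScale [IsUltrametricDist K] {μ : Measure (ℕ → K)}
    [IsFiniteMeasure μ] (hμ : ShearInvariant μ) {ρ : K} (hρ : IsUniformizer ρ) :
    (μ.prod (stdKGaussianSeq K)).map (fun p => (scaleOf ρ p.1, divByScale ρ p.1 p.2)) =
      (μ.map (scaleOf ρ)).prod (stdKGaussianSeq K) := by
  have := secondCountableTopology_of_locallyCompactSpace K
  have hs := measurable_scaleOf ρ
  have hs' : Measurable fun p : (ℕ → K) × (ℕ → K) => scaleOf ρ p.1 := hs.comp measurable_fst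
  have hH := hs'.prodMk (measurable_divByScale ρ)
  refine (Measure.prod_eq fun A B hA hB => ?_).symm
  rw [Measure.map_apply hH (hA.prod hB), Measure.map_apply hs hA,
    measure_eq_tsum_inter_preimage_singleton _ hs' (countable_insert_zero_range_zpow ρ)
      (fun p => scaleOf_mem ρ p.1) (hH (hA.prod hB)),
    measure_eq_tsum_inter_preimage_singleton μ hs (countable_insert_zero_range_zpow ρ)
      (scaleOf_mem ρ) (hs hA), ← ENNReal.tsum_mul_right]
  refine tsum_congr ?_
  rintro ⟨c, hc⟩
  by_cases hcA : c ∈ A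
  swap
  · rw [Set.eq_empty_of_forall_notMem (s := _ ∩ _), Set.eq_empty_of_forall_notMem (s := _ ∩ _)]
    · simp
    · rintro x ⟨hxA, rfl⟩
      exact hcA hxA
    · rintro p ⟨hpA, rfl⟩
      exact hcA hpA.1
  have hleft : scaleOf ρ ⁻¹' A ∩ scaleOf ρ ⁻¹' {c} = scaleOf ρ ⁻¹' {c} := by
    refine Set.inter_eq_right.2 ?_
    rintro x rfl
    exact hcA
  rw [hleft]
  -- At scale zero the second component is the auxiliary sequence, independent by construction; at
  -- scale `ρ ^ m` the law comes from `map_restrict_div`.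
  rcases eq_or_ne c 0 with rfl | hc0
  · rw [← Measure.prod_prod]
    congr 1
    ext p
    simp only [Set.mem_inter_iff, Set.mem_preimage, Set.mem_prod, Set.mem_singleton_iff]
    constructor
    · rintro ⟨⟨-, h⟩, h0⟩
      rw [divByScale, if_pos h0] at h
      exact ⟨h0, h⟩
    · rintro ⟨h0, h⟩
      refine ⟨⟨by rwa [h0], ?_⟩, h0⟩
      rwa [divByScale, if_pos h0]
  · obtain ⟨m, rfl⟩ : ∃ m : ℤ, ρ ^ m = c := (Set.mem_insert_iff.1 hc).resolve_left hc0
    have hdiv : Measurable fun (x : ℕ → K) i => x i / ρ ^ m := by fun_prop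
    have h := hμ.map_restrict_div hc0 (F := scaleOf ρ ⁻¹' {ρ ^ m}) fun x =>
      (hρ.scaleOf_eq_zpow_iff x m).trans (hρ.supAbs_eq_enorm_iff hc0 x)
    have hB' := congrArg (fun ν : Measure (ℕ → K) => ν B) h
    simp only [Measure.map_apply hdiv hB, Measure.restrict_apply (hdiv hB), Measure.smul_apply,
      smul_eq_mul] at hB'
    rw [← hB', ← mul_one (μ _), ← measure_univ (μ := stdKGaussianSeq K), ← Measure.prod_prod]
    congr 1
    ext p
    simp only [Set.mem_inter_iff, Set.mem_preimage, Set.mem_prod, Set.mem_singleton_iff,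
      Set.mem_univ, and_true]
    refine and_congr_left fun hp => ?_
    rw [divByScale, hp, if_neg hc0]
    exact and_iff_right hcA

end LocalField

/-! ### Transfer along extensions and the main theorem. -/

theorem Rotatable.of_isExtension {K : Type v} [NormedField K] [IsUltrametricDist K]
    [SecondCountableTopology K] [MeasurableSpace K] [BorelSpace K] {Ω : Type u}
    [MeasurableSpace Ω] {P : Measure Ω} {ξ : ℕ → Ω → K} (hξ : ∀ i, Measurable (ξ i))
    {Ω' : Type (max u v)} [MeasurableSpace Ω'] {P' : Measure Ω'} {π : Ω' → Ω}
    (hπ : IsExtension.{u, v} P P' π) {ζ : ℕ → Ω' → K} (hζ : Rotatable P' ζ)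
    (h : ∀ᵐ ω ∂P', ∀ i, ξ i (π ω) = ζ i ω) : Rotatable P ξ := by
  intro n U
  have hm : Measurable fun ω (i : Fin n) => ξ i ω := by fun_prop
  have hA : Measurable ((U : Matrix (Fin n) (Fin n) (ringOfIntegers K)).map
      (fun a => (a : K))).mulVec :=
    (Continuous.matrix_mulVec continuous_const continuous_id).measurable
  have hmap {f : Ω → Fin n → K} {g : Ω' → Fin n → K} (hf : Measurable f)
      (hfg : ∀ᵐ ω ∂P', f (π ω) = g ω) : P.map f = P'.map g := by
    rw [← hπ.measurePreserving.map_eq, Measure.map_map hf hπ.measurePreserving.measurable]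
    exact Measure.map_congr hfg
  rw [hmap hm (h.mono fun ω hω => funext fun i => hω i), ← hζ n U]
  exact hmap (hA.comp hm) (h.mono fun ω hω => by simp only [hω])

theorem theoremT {K : Type v} [NontriviallyNormedField K] [IsUltrametricDist K]
    [LocallyCompactSpace K] [MeasurableSpace K] [BorelSpace K]
    (ρ : K) (hρ : IsUniformizer ρ)
    {Ω : Type u} [MeasurableSpace Ω] (P : Measure Ω) [IsProbabilityMeasure P]
    (ξ : ℕ → Ω → K) (hξ : ∀ i, Measurable (ξ i)) :
    Rotatable P ξ ↔
      (∀ᵐ ω ∂P, supAbs (fun j => ξ j ω) < ∞) ∧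
      ∃ (Ω' : Type (max u v)) (_ : MeasurableSpace Ω') (P' : Measure Ω') (π : Ω' → Ω)
        (η : ℕ → Ω' → K),
        IsExtension.{u, v} P P' π ∧
        (∀ i, Measurable (η i)) ∧
        (∀ᵐ ω ∂P', ∀ i, ξ i (π ω) = scaleOf ρ (fun j => ξ j (π ω)) * η i ω) ∧
        iIndepFun η P' ∧
        (∀ i, P'.map (η i) = stdKGaussian K) ∧
        IndepFun (fun ω => scaleOf ρ (fun j => ξ j (π ω))) (fun ω i => η i ω) P' := by
  have := secondCountableTopology_of_locallyCompactSpace K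
  have hX : Measurable fun ω i => ξ i ω := by fun_prop
  have hs := measurable_scaleOf ρ
  constructor
  · intro h
    have hμ := h.shearInvariant hξ
    have : IsProbabilityMeasure (P.map fun ω i => ξ i ω) :=
      Measure.isProbabilityMeasure_map hX.aemeasurable
    have hfin : ∀ᵐ ω ∂P, supAbs (fun j => ξ j ω) < ∞ :=
      ae_of_ae_map hX.aemeasurable hμ.ae_supAbs_lt_top
    -- The extension is `Ω` times an independent Gaussian sequence, which is used only where the
    -- scale is zero.
    let N : Ω × (ℕ → K) → ℕ → K := fun p => divByScale ρ (fun j => ξ j p.1) p.2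
    have hXid : Measurable (Prod.map (fun ω i => ξ i ω) id : Ω × (ℕ → K) → _) :=
      hX.prodMap measurable_id
    have hN : Measurable N := (measurable_divByScale ρ).comp hXid
    have hτ : Measurable fun p : Ω × (ℕ → K) => scaleOf ρ fun j => ξ j p.1 :=
      hs.comp (hX.comp measurable_fst)
    have hfst : MeasurePreserving Prod.fst (P.prod (stdKGaussianSeq K)) P :=
      measurePreserving_fst
    have hjoint : (P.prod (stdKGaussianSeq K)).map (fun p => (scaleOf ρ fun j => ξ j p.1, N p)) =
        ((P.map fun ω i => ξ i ω).map (scaleOf ρ)).prod (stdKGaussianSeq K) := by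
      rw [← hμ.map_scaleOf_divByScale hρ]
      conv_rhs => rw [← Measure.map_id (μ := stdKGaussianSeq K)]
      rw [Measure.map_prod_map _ _ hX measurable_id]
      exact (Measure.map_map
        ((hs.comp measurable_fst).prodMk (measurable_divByScale ρ)) hXid).symm
    have : IsProbabilityMeasure ((P.map fun ω i => ξ i ω).map (scaleOf ρ)) :=
      Measure.isProbabilityMeasure_map hs.aemeasurable
    have hNlaw : (P.prod (stdKGaussianSeq K)).map N = stdKGaussianSeq K := by
      have h2 := congrArg (Measure.map Prod.snd) hjoint
      rw [Measure.map_map measurable_snd (hτ.prodMk hN), Measure.map_snd_prod, measure_univ,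
        one_smul] at h2
      exact h2
    have hτlaw : (P.prod (stdKGaussianSeq K)).map (fun p => scaleOf ρ fun j => ξ j p.1) =
        (P.map fun ω i => ξ i ω).map (scaleOf ρ) := by
      have h1 := congrArg (Measure.map Prod.fst) hjoint
      rw [Measure.map_map measurable_fst (hτ.prodMk hN), Measure.map_fst_prod, measure_univ,
        one_smul] at h1
      exact h1
    have hNi (i : ℕ) : (P.prod (stdKGaussianSeq K)).map (fun p => N p i) = stdKGaussian K := by
      have hi := congrArg (Measure.map fun x => x i) hNlaw
      rw [Measure.map_map (measurable_pi_apply i) hN, map_eval_stdKGaussianSeq] at hi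
      exact hi
    refine ⟨hfin, Ω × (ℕ → K), inferInstance, P.prod (stdKGaussianSeq K), Prod.fst,
      fun i p => N p i, ⟨inferInstance, hfst, Prod.fst_surjective⟩, fun i => hN.eval, ?_, ?_, hNi,
      ?_⟩
    · filter_upwards [hfst.quasiMeasurePreserving.ae hfin] with p hp i
      by_cases h0 : scaleOf ρ (fun j => ξ j p.1) = 0
      · rw [h0, zero_mul]
        exact hρ.eq_zero_of_scaleOf_eq_zero hp.ne h0 i
      · simp only [N, divByScale, if_neg h0]
        exact (mul_div_cancel₀ _ h0).symm
    · refine (iIndepFun_iff_map_fun_eq_infinitePi_map fun i => hN.eval).2 ?_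
      simp only [hNi]
      exact hNlaw
    · refine (indepFun_iff_map_prod_eq_prod_map_map hτ.aemeasurable hN.aemeasurable).2 ?_
      rw [hτlaw, hjoint, hNlaw]
  · rintro ⟨-, Ω', _, P', π, η, hπ, hη, heq, hind, hlaw, hτη⟩
    have := hπ.isProbabilityMeasure
    exact .of_isExtension hξ hπ (rotatable_mul_of_indepFun
      (hs.comp (hX.comp hπ.measurePreserving.measurable)) hη hlaw hind hτη) heq
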